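/- Let $(\mathscr V,\mathscr E)$ be a countable connected directed acyclic graph and let $\prec$ be the partial order it induces ($w\prec v$ iff there is a directed path from $w$ to $v$); let $\mathrm{pa}(v)$ be the set of parents of $v$. Suppose that $\mathscr V$ is the disjoint union of a set $\mathscr C$ of communication nodes and a set $\mathscr I$ of initial nodes, that no edge goes from $\mathscr C$ to $\mathscr I$, and that $\mathscr V=\bigcup_n\mathcal V_n$ for an increasing sequence of finite sets $\mathcal V_n$ that contain, with each $v$, all $w\prec v$. Put $\mathcal C_n=\mathcal V_n\cap\mathscr C$. Let $\mathcal X,\mathcal Y$ be finite nonempty alphabets. A poset-Markov channel on these data consists of an arbitrary fixed joint law $P_0$ of the outputs $(Y_v)_{v\in\mathscr I}$ of the initial nodes and, for each $v\in\mathscr C$, a conditional law $P_{Y_v\mid X^{\preceq v},Y^{\prec v}}$ on $\mathcal Y$ that depends only on the input $X_v$ and on the parents' outputs $Y_{\mathrm{pa}(v)}$, i.e. equals $P_{Y_v\mid X_v,Y_{\mathrm{pa}(v)}}$. An $(n,M,\epsilon)$-code ($M\ge 1$) consists of encoding maps $f_v\colon[M]\times\mathcal Y^{\{w\,:\,w\prec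 v\}}\to\mathcal X$, $v\in\mathcal C_n$, and a decoder $g\colon\mathcal Y^{\mathcal C_n}\to[M]$ such that, for a message $W$ uniform on $[M]$, inputs $X_v=f_v(W,Y^{\prec v})$ and $\hat W=g((Y_v)_{v\in\mathcal C_n})$, one has $\mathbb P[W\ne\hat W]\le\epsilon$. Let $M^*(n,\epsilon)$ be the largest $M$ for which an $(n,M,\epsilon)$-code exists, and let $$C^{\mathrm{fb}}=\lim_{\epsilon\downarrow0}\ \liminf_{n\to\infty}\ \frac1{|\mathcal C_n|}\log M^*(n,\epsilon).$$ For each $n$ consider the program $$U_n=\max_{\{P_{X_v,Y_{\mathrm{pa}(v)}}\}_{v\in\mathcal C_n}}\ \frac1{|\mathcal C_n|}\sum_{v\in\mathcal C_n}I(X_v;Y_v\mid Y_{\mathrm{pa}(v)})$$ over families of probability distributions $P_{X_v,Y_{\mathrm{pa}(v)}}$ on $\mathcal X\times\mathcal Y^{\mathrm{pa}(v)}$, where the $v$-th term is computed for the joint law $P_{X_v,Y_{\mathrm{pa}(v)}}P_{Y_v\mid X_v,Y_{\mathrm{pa}(v)}}$, subject to the following two constraints: 1. $P_{Y_v}=\sum_{x_v,y_{\mathrm{pa}(v)}}P_{Y_v\mid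 X_v,Y_{\mathrm{pa}(v)}}P_{X_v,Y_{\mathrm{pa}(v)}}$ for all $v\in\mathcal C_n$, where $P_{Y_v}$ is also the marginal at $Y_v$ of $P_{X_u,Y_{\mathrm{pa}(u)}}$ for every $u\in\mathcal C_n$ with $v\in\mathrm{pa}(u)$; 2. for all $u,v\in\mathcal C_n$, the distributions $P_{X_u,Y_{\mathrm{pa}(u)}}$ and $P_{X_v,Y_{\mathrm{pa}(v)}}$ have the same marginal on $Y_{\mathrm{pa}(u)\cap\mathrm{pa}(v)}$. (For $n$ with $\mathcal C_n=\emptyset$, the factor $1/|\mathcal C_n|$ is read as $0$.) Then the following hold. The maximum $M^*(n,\epsilon)$ exists for all $n$ and $0<\epsilon<1$, and the limit in $\epsilon$ that defines $C^{\mathrm{fb}}$ exists. Each of the programs is the maximization of a concave function over a convex set, and its maximum $U_n$ is attained. Moreover $$C^{\mathrm{fb}}\ \le\ \liminf_{n\to\infty}U_n;$$ in particular $C^{\mathrm{fb}}\le\lim_{n\to\infty}U_n$ whenever this limit exists. -/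

import Mathlib

open Filter Topology MeasureTheory

noncomputable section

/-- A poset-causal channel over the poset `V`, with input alphabet `X` and output alphabet `Y`.
`comm` is the set of communication nodes; its complement is the set of initial nodes. -/
structure PosetCausalChannel (V X Y : Type*) [PartialOrder V] [Fintype Y]
    [MeasurableSpace Y] where
  /-- the communication nodes -/
  comm : Set V
  /-- the increasing sequence of finite sets of nodes -/
  nodes : ℕ → Finset V
  nodes_mono : Monotone nodes
  nodes_cover : ∀ v, ∃ n, v ∈ nodes n
  nodes_lower : ∀ n v w, v ∈ nodes n → w < v → w ∈ nodes n
  /-- No initial node comes after a communication node. When the order is generated by the edges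
  of a DAG this says precisely that no edge goes from a communication node to an initial node. -/
  comm_upper : ∀ v w, v ∈ comm → v < w → w ∈ comm
  /-- the joint law of the outputs of all initial nodes -/
  init : ProbabilityMeasure ({v : V // v ∉ comm} → Y)
  /-- the conditional law of the output of `v`, given the inputs of the communication nodes `≤ v`
  and the outputs of all nodes `< v` -/
  law : (v : comm) → ({w : comm // w ≤ v} → X) → ({w : V // w < v} → Y) → stdSimplex ℝ Y

namespace PosetCausalChannel

variable {V X Y : Type*} [PartialOrder V] [Fintype Y] [MeasurableSpace Y]

/-- The communication nodes that are used in the first `n` stages. -/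
abbrev CommNode (ch : PosetCausalChannel V X Y) (n : ℕ) : Type _ :=
  {v : ch.comm // (v : V) ∈ ch.nodes n}

instance (ch : PosetCausalChannel V X Y) (n : ℕ) : Fintype (ch.CommNode n) :=
  Fintype.ofInjective (fun v : ch.CommNode n => (⟨v.1.1, v.2⟩ : ch.nodes n)) (by
    intro a b h
    exact Subtype.ext (Subtype.ext (congrArg (fun t : ch.nodes n => (t : V)) h)))

/-- The number of communication nodes used in the first `n` stages. -/
def numComm (ch : PosetCausalChannel V X Y) (n : ℕ) : ℕ := Fintype.card (ch.CommNode n)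

/-- A feedback encoder over `n` stages for `M` messages: the input at `v` is a function of the
message and of the outputs of the nodes that strictly precede `v`. -/
abbrev Encoder (ch : PosetCausalChannel V X Y) (n M : ℕ) : Type _ :=
  (v : ch.CommNode n) → Fin M → ({w : V // w < (v.1 : V)} → Y) → X

/-- A decoder sees the outputs of the communication nodes only. -/
abbrev Decoder (ch : PosetCausalChannel V X Y) (n M : ℕ) : Type _ :=
  (ch.CommNode n → Y) → Fin M

/-- The outputs strictly before the node `v`, read off from the outputs of the first `n` stages. -/
def past (ch : PosetCausalChannel V X Y) {n : ℕ} (y : ch.nodes n → Y) (v : V)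
    (hv : v ∈ ch.nodes n) : {w : V // w < v} → Y :=
  fun w => y ⟨w.1, ch.nodes_lower n v w.1 hv w.2⟩

/-- The probability that the initial nodes among the first `n` stages have the outputs
prescribed by `y`. -/
def initProb (ch : PosetCausalChannel V X Y) {n : ℕ} (y : ch.nodes n → Y) : ℝ :=
  (ch.init : Measure ({v : V // v ∉ ch.comm} → Y)).real
    {z | ∀ (i : {v : V // v ∉ ch.comm}) (h : i.1 ∈ ch.nodes n), z i = y ⟨i.1, h⟩}

/-- A node `≤ v` is among the first `n` stages if `v` is. -/
theorem mem_nodes_of_le (ch : PosetCausalChannel V X Y) {n : ℕ} (v : ch.CommNode n)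
    (u : {w : ch.comm // w ≤ v.1}) : (u.1 : V) ∈ ch.nodes n := by
  rcases lt_or_eq_of_le u.2 with h | h
  · exact ch.nodes_lower n v.1 u.1 v.2 h
  · have h2 : ((u.1 : ch.comm) : V) = ((v.1 : ch.comm) : V) := congrArg Subtype.val h
    rw [h2]
    exact v.2

/-- The probability of the outputs `y` of all nodes of the first `n` stages, when message `m` is
sent with the encoder `f`. -/
def outputProb (ch : PosetCausalChannel V X Y) {n M : ℕ} (f : ch.Encoder n M) (m : Fin M)
    (y : ch.nodes n → Y) : ℝ :=
  ch.initProb y *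
    ∏ v : ch.CommNode n,
      (ch.law v.1
        (fun u => f ⟨u.1, ch.mem_nodes_of_le v u⟩ m
          (ch.past y u.1 (ch.mem_nodes_of_le v u)))
        (ch.past y v.1 v.2)).1 (y ⟨v.1, v.2⟩)

open scoped Classical in
/-- The error probability of a code, the message being uniformly distributed. -/
def errorProb (ch : PosetCausalChannel V X Y) {n M : ℕ} (f : ch.Encoder n M)
    (g : ch.Decoder n M) : ℝ :=
  (1 / (M : ℝ)) * ∑ m : Fin M, ∑ y : ch.nodes n → Y,
    if g (fun v => y ⟨v.1, v.2⟩) ≠ m then ch.outputProb f m y else 0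

/-- The sizes `M` for which there is an `(n, M, ε)`-code. -/
def codeSizes (ch : PosetCausalChannel V X Y) (n : ℕ) (ε : ℝ) : Set ℕ :=
  {M | 1 ≤ M ∧ ∃ (f : ch.Encoder n M) (g : ch.Decoder n M), ch.errorProb f g ≤ ε}

/-- The maximal message size with error probability at most `ε` after `n` stages. -/
def maxSize (ch : PosetCausalChannel V X Y) (n : ℕ) (ε : ℝ) : ℕ := sSup (ch.codeSizes n ε)

/-- The asymptotic rate with error probability at most `ε`. -/
def epsRate (ch : PosetCausalChannel V X Y) (ε : ℝ) : EReal :=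
  liminf (fun n => ((1 / (ch.numComm n : ℝ) * Real.log (ch.maxSize n ε) : ℝ) : EReal)) atTop

/-- The feedback capacity: the limit of the rates as the error probability decreases to `0`. -/
def feedbackCapacity (ch : PosetCausalChannel V X Y) : EReal :=
  limUnder (𝓝[>] (0 : ℝ)) ch.epsRate

end PosetCausalChannel

/-- A poset-Markov channel: the order is generated by the directed paths of a connected DAG, and
the output at a communication node depends only on the input there and on the outputs of its
parents. Acyclicity is part of `lt_iff_path`, since `<` is irreflexive. -/
structure PosetMarkovChannel (V X Y : Type*) [PartialOrder V] [Fintype Y]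
    [MeasurableSpace Y] extends PosetCausalChannel V X Y where
  edge : V → V → Prop
  lt_iff_path : ∀ v w, v < w ↔ Relation.TransGen edge v w
  connected : (SimpleGraph.fromRel edge).Connected
  /-- the conditional law of the output at `v`, given the input at `v` and the parents' outputs -/
  localLaw : (v : comm) → X → ({w : V // edge w v} → Y) → stdSimplex ℝ Y
  markov : ∀ (v : comm) (x : {w : comm // w ≤ v} → X) (y : {w : V // w < v} → Y),
    law v x y =
      localLaw v (x ⟨v, le_rfl⟩)
        (fun w => y ⟨w.1, (lt_iff_path w.1 v).2 (Relation.TransGen.single w.2)⟩)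

/-- The conditional mutual information `I(A; B | C)`, in nats, of three finite random variables
with joint probability mass function `p a b c`. Terms with `p a b c = 0` vanish; in all others the
denominator is positive. -/
def condMutualInfo {A B C : Type*} [Fintype A] [Fintype B] [Fintype C] (p : A → B → C → ℝ) : ℝ :=
  ∑ a, ∑ b, ∑ c, p a b c *
    Real.log ((p a b c * ∑ a', ∑ b', p a' b' c) / ((∑ b', p a b' c) * ∑ a', p a' b c))

namespace PosetMarkovChannel

variable {V X Y : Type*} [PartialOrder V] [Fintype X] [Fintype Y] [MeasurableSpace Y]

/-- The parents of a node. -/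
abbrev Pa (ch : PosetMarkovChannel V X Y) (v : V) : Type _ := {w : V // ch.edge w v}

instance (ch : PosetMarkovChannel V X Y) (v : V) : Finite (ch.Pa v) := by
  obtain ⟨n, hn⟩ := ch.nodes_cover v
  exact Finite.of_injective
    (fun w : ch.Pa v => (⟨w.1, ch.nodes_lower n v w.1 hn
      ((ch.lt_iff_path w.1 v).2 (Relation.TransGen.single w.2))⟩ : ch.nodes n))
    (fun a b h => Subtype.ext (congrArg (fun t : ch.nodes n => (t : V)) h))

instance (ch : PosetMarkovChannel V X Y) (v : V) : Fintype (ch.Pa v) := Fintype.ofFinite _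

open scoped Classical in
instance (ch : PosetMarkovChannel V X Y) (v : V) : Fintype (ch.Pa v → Y) := inferInstance

/-- The variables of the `n`-th program: for every communication node `v` of the first `n` stages,
a function that stands for the joint law of the input at `v` and the outputs of its parents. -/
abbrev LocalVars (ch : PosetMarkovChannel V X Y) (n : ℕ) : Type _ :=
  (v : ch.CommNode n) → X × (ch.Pa v.1 → Y) → ℝ

/-- The joint law of the input at `v`, the output at `v` and the outputs of the parents of `v`
that results from the channel law and a joint law of the first and the third of these. -/
def localJoint (ch : PosetMarkovChannel V X Y) (v : ch.comm) (p : X × (ch.Pa v → Y) → ℝ) :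
    X → Y → (ch.Pa v → Y) → ℝ :=
  fun x b y => (ch.localLaw v x y).1 b * p (x, y)

open scoped Classical in
/-- The feasible set of the `n`-th program. -/
def feasible (ch : PosetMarkovChannel V X Y) (n : ℕ) : Set (ch.LocalVars n) :=
  {P | (∀ v, P v ∈ stdSimplex ℝ (X × (ch.Pa v.1 → Y))) ∧
    -- the channel law at `v` determines the marginal at `v` for each child `u` of `v`
    (∀ (u v : ch.CommNode n) (h : ch.edge v.1 u.1) (b : Y),
      (∑ x, ∑ y : ch.Pa u.1 → Y, if y ⟨v.1, h⟩ = b then P u (x, y) else 0) =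
        ∑ x, ∑ y : ch.Pa v.1 → Y, ch.localJoint v.1 (P v) x b y) ∧
    -- any two nodes agree on the joint marginal at their common parents
    (∀ (u v : ch.CommNode n) (z : {w : V // ch.edge w u.1 ∧ ch.edge w v.1} → Y),
      (∑ x, ∑ y : ch.Pa u.1 → Y, if ∀ w, y ⟨w.1, w.2.1⟩ = z w then P u (x, y) else 0) =
        ∑ x, ∑ y : ch.Pa v.1 → Y, if ∀ w, y ⟨w.1, w.2.2⟩ = z w then P v (x, y) else 0)}

/-- The objective of the `n`-th program: the average of the local conditional mutual information
between input and output at `v` given the outputs of the parents of `v`. -/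
def objective (ch : PosetMarkovChannel V X Y) (n : ℕ) (P : ch.LocalVars n) : ℝ :=
  1 / (ch.numComm n : ℝ) * ∑ v : ch.CommNode n, condMutualInfo (ch.localJoint v.1 (P v))

/-- The value of the `n`-th program. -/
def programValue (ch : PosetMarkovChannel V X Y) (n : ℕ) : ℝ :=
  sSup (ch.objective n '' ch.feasible n)

end PosetMarkovChannel

end

/-!
The upper bound comes from a single application of Gibbs' inequality, which takes the place of
Fano's inequality, the chain rule and data processing.

Fix a code with error probability at most `ε`. For a message `m` and outputs `y` of the first `n`
stages its law is `p(m, y) = M⁻¹ a(y) ∏ᵥ L_v(y_v | x_v, y_pa(v))`, where `a` is the law of the initial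
outputs. It is compared with `q(m, y) = Q(m | g(y)) a(y) ∏ᵥ r_v(y_v | y_pa(v))`, where `r_v` is the
conditional law of `Y_v` given the parents' outputs under the code, and
`Q(m | k) = (1 - ε) 1[m = k] + ε / M`. In the expectation of `log (p / q)` the factor `a` cancels, the
quotients `L_v / r_v` contribute `∑ᵥ I(X_v; Y_v | Y_pa(v))`, and `Q` contributes at most
`-log (1 - ε) + ε (log M - log ε)`. Nonnegativity of relative entropy therefore gives
`(1 - ε) log M ≤ ∑ᵥ I(X_v; Y_v | Y_pa(v)) + fanoExcess ε` (`log_card_le_sum_condMutualInfo`).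
Since the channel is Markov, the laws of `(X_v, Y_pa(v))` under the code form a feasible point of the
`n`-th program (`inducedLaw_mem_feasible`), so the sum is at most `|𝒞ₙ| Uₙ`. As `fanoExcess ε → 0`, the
bound survives division by `|𝒞ₙ|` even if the numbers `|𝒞ₙ|` stay bounded. It also bounds `M` for fixed
`n` and `ε < 1`, so the maximal code size exists.

That `p` and `q` have total mass one, and that the output at `v` has the channel law given the past,
follows by summing out causal kernels, a maximal node first (`IsCausalKernel.sum_mul_prod` and
`IsCausalKernel.sum_mul_prod_mul`); no linear extension of the order is needed.

For the program, the objective is a linear function plus a conditional entropy of output given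
state (`condMutualInfo_eq_sub`). It is concave by the log-sum inequality, and continuous since it is a
combination of values of `x log x`; the feasible set is compact and convex.
-/

noncomputable section

-- Sections below share their finiteness assumptions, which not every lemma needs.
set_option linter.unusedSectionVars false

/-! ### Gibbs' inequality and the log-sum inequality -/

theorem sub_le_mul_log_div {p q : ℝ} (hp : 0 ≤ p) (hq : 0 ≤ q) (hpq : q = 0 → p = 0) :
    p - q ≤ p * Real.log (p / q) := by
  rcases hp.eq_or_lt with rfl | hp
  · simpa using hq
  have hq0 : 0 < q := hq.lt_of_ne fun h => hp.ne' (hpq h.symm)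
  have h := Real.log_le_sub_one_of_pos (div_pos hq0 hp)
  have h2 : Real.log (p / q) = - Real.log (q / p) := by rw [← Real.log_inv, inv_div]
  have h3 : p * Real.log (q / p) ≤ p * (q / p - 1) := mul_le_mul_of_nonneg_left h hp.le
  have h4 : p * (q / p - 1) = q - p := by field_simp
  rw [h2]
  linarith

/-- Gibbs' inequality: relative entropy is nonnegative. -/
theorem sum_mul_log_div_nonneg {ι : Type*} [Fintype ι] (p q : ι → ℝ) (hp : ∀ i, 0 ≤ p i)
    (hq : ∀ i, 0 ≤ q i) (hpq : ∀ i, q i = 0 → p i = 0) (h : ∑ i, q i ≤ ∑ i, p i) :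
    0 ≤ ∑ i, p i * Real.log (p i / q i) := by
  have h1 : ∑ i, (p i - q i) ≤ ∑ i, p i * Real.log (p i / q i) :=
    Finset.sum_le_sum fun i _ => sub_le_mul_log_div (hp i) (hq i) (hpq i)
  rw [Finset.sum_sub_distrib] at h1
  linarith

/-- The log-sum inequality for two summands. -/
theorem add_mul_log_div_add_le {p q s t : ℝ} (hp : 0 ≤ p) (hq : 0 ≤ q) (hs : 0 ≤ s) (ht : 0 ≤ t)
    (hps : s = 0 → p = 0) (hqt : t = 0 → q = 0) :
    (p + q) * Real.log ((p + q) / (s + t)) ≤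
      p * Real.log (p / s) + q * Real.log (q / t) := by
  rcases (add_nonneg hs ht).eq_or_lt with h0 | hst
  · have hs0 : s = 0 := by linarith
    have ht0 : t = 0 := by linarith
    simp [hps hs0, hqt ht0]
  rcases (add_nonneg hp hq).eq_or_lt with h0 | hpq
  · have hp0 : p = 0 := by linarith
    have hq0 : q = 0 := by linarith
    simp [hp0, hq0]
  have hc : 0 < (p + q) / (s + t) := div_pos hpq hst
  -- each ratio is compared with the common ratio `c = (p + q) / (s + t)`
  have key : ∀ a b : ℝ, 0 ≤ a → 0 ≤ b → (b = 0 → a = 0) →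
      a - b * ((p + q) / (s + t)) + a * Real.log ((p + q) / (s + t)) ≤ a * Real.log (a / b) := by
    intro a b ha hb hab
    rcases ha.eq_or_lt with rfl | ha
    · have := mul_nonneg hb hc.le
      simp only [zero_mul, zero_sub, add_zero]
      linarith
    have hb0 : 0 < b := hb.lt_of_ne fun h => ha.ne' (hab h.symm)
    have h := sub_le_mul_log_div ha.le (mul_nonneg hb hc.le)
      (fun h => absurd h (mul_pos hb0 hc).ne')
    rw [← div_div, Real.log_div (div_pos ha hb0).ne' hc.ne'] at h
    linarith
  have h1 := key p s hp hs hps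
  have h2 := key q t hq ht hqt
  have h3 : s * ((p + q) / (s + t)) + t * ((p + q) / (s + t)) = p + q := by field_simp
  nlinarith

/-! ### Sums of products of causal kernels -/

section Causal

variable {I N Y : Type*} [Fintype N] [DecidableEq N] [Fintype Y]

theorem sum_sum_update (i : N) (φ : (N → Y) → ℝ) :
    ∑ y, ∑ b, φ (Function.update y i b) = (Fintype.card Y : ℝ) * ∑ y, φ y := by
  -- `(y, b) ↦ (update y i b, y i)` is an involution
  have h : ∑ z : (N → Y) × Y, φ (Function.update z.1 i z.2) = ∑ z : (N → Y) × Y, φ z.1 := by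
    refine Finset.sum_nbij' (fun z => (Function.update z.1 i z.2, z.1 i))
      (fun z => (Function.update z.1 i z.2, z.1 i)) ?_ ?_ ?_ ?_ ?_ <;> simp
  rw [Fintype.sum_prod_type, Fintype.sum_prod_type] at h
  rw [h, Finset.mul_sum]
  simp

/-- Of a factor, only its sum over the coordinate `i` matters, if the cofactor does not depend on
that coordinate. -/
theorem sum_mul_congr_of_sum_update [Nonempty Y] (i : N) (A B G : (N → Y) → ℝ)
    (hG : ∀ y b, G (Function.update y i b) = G y)
    (h : ∀ y, ∑ b, A (Function.update y i b) = ∑ b, B (Function.update y i b)) :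
    ∑ y, A y * G y = ∑ y, B y * G y := by
  have hc : (Fintype.card Y : ℝ) ≠ 0 := Nat.cast_ne_zero.2 Fintype.card_ne_zero
  refine mul_left_cancel₀ hc ?_
  rw [← sum_sum_update i, ← sum_sum_update i]
  refine Finset.sum_congr rfl fun y _ => ?_
  simp only [hG, ← Finset.sum_mul, h]

/-- A family of causal kernels: the factor `K i` is a conditional law for the coordinate `e i`
and does not depend on the coordinates `e j` with `j` not below `i`. -/
structure IsCausalKernel [PartialOrder I] (e : I → N) (K : I → (N → Y) → ℝ) : Prop where
  update_eq : ∀ i j, ¬ j ≤ i → ∀ y b, K i (Function.update y (e j) b) = K i y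
  sum_update : ∀ i y, ∑ b, K i (Function.update y (e i) b) = 1

variable [PartialOrder I] [Nonempty Y] {e : I → N} {K : I → (N → Y) → ℝ}

/-- Causal kernels can be summed out, a maximal index first. -/
theorem IsCausalKernel.sum_mul_prod (hK : IsCausalKernel e K) (U : Finset I) (H : (N → Y) → ℝ)
    (hH : ∀ i ∈ U, ∀ y b, H (Function.update y (e i) b) = H y) :
    ∑ y, H y * ∏ i ∈ U, K i y = ((Fintype.card Y : ℝ)⁻¹) ^ U.card * ∑ y, H y := by
  classical
  induction U using Finset.strongInduction with
  | H U ih =>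
    rcases U.eq_empty_or_nonempty with rfl | hne
    · simp
    obtain ⟨i, hi, hmax⟩ := U.exists_maximal hne
    have h1 : ∑ y, H y * ∏ j ∈ U, K j y = ∑ y, K i y * (H y * ∏ j ∈ U.erase i, K j y) := by
      refine Finset.sum_congr rfl fun y _ => ?_
      rw [← Finset.mul_prod_erase U (fun j => K j y) hi]
      ring
    rw [h1, sum_mul_congr_of_sum_update (e i) (K i) (fun _ => (Fintype.card Y : ℝ)⁻¹),
      ← Finset.mul_sum, ih _ (Finset.erase_ssubset hi)
        (fun j hj => hH j (Finset.mem_of_mem_erase hj)),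
      ← mul_assoc, ← pow_succ', Finset.card_erase_add_one hi]
    · intro y b
      simp only [hH i hi]
      congr 1
      refine Finset.prod_congr rfl fun j hj => hK.update_eq j i (fun hij => ?_) y b
      obtain ⟨hji, hj⟩ := Finset.mem_erase.1 hj
      exact hji (le_antisymm (hmax hj hij) hij)
    · intro y
      rw [hK.sum_update i y]
      simp

/-- Under a causal product, the mean of a function `φ` that involves no communication coordinate
other than those up to `i` does not change when the coordinate `i` is averaged out by its kernel:
the kernels at indices not below `i` are summed out first, and the one at `i` next. -/
theorem IsCausalKernel.sum_mul_prod_mul [Fintype I] (hK : IsCausalKernel e K) (i : I)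
    (a φ ψ : (N → Y) → ℝ)
    (ha : ∀ j y b, a (Function.update y (e j) b) = a y)
    (hφ : ∀ j, ¬ j ≤ i → ∀ y b, φ (Function.update y (e j) b) = φ y)
    (hψ : ∀ j, ¬ j < i → ∀ y b, ψ (Function.update y (e j) b) = ψ y)
    (h : ∀ y, ∑ b, K i (Function.update y (e i) b) * φ (Function.update y (e i) b) = ψ y) :
    ∑ y, (a y * ∏ j, K j y) * φ y = ∑ y, (a y * ∏ j, K j y) * ψ y := by
  classical
  set D : Finset I := Finset.univ.filter (· ≤ i) with hD
  set U : Finset I := Finset.univ.filter (¬ · ≤ i) with hU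
  have hiD : i ∈ D := by simp [hD]
  have split : ∀ χ : (N → Y) → ℝ, (∀ j, ¬ j ≤ i → ∀ y b, χ (Function.update y (e j) b) = χ y) →
      ∑ y, (a y * ∏ j, K j y) * χ y = ((Fintype.card Y : ℝ)⁻¹) ^ U.card *
        ∑ y, (K i y * χ y) * (a y * ∏ j ∈ D.erase i, K j y) := by
    intro χ hχ
    rw [← hK.sum_mul_prod U]
    · refine Finset.sum_congr rfl fun y _ => ?_
      rw [← Finset.prod_filter_mul_prod_filter_not Finset.univ (· ≤ i),
        ← Finset.mul_prod_erase D (fun j => K j y) hiD]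
      ring
    · intro j hj y b
      have hji : ¬ j ≤ i := (Finset.mem_filter.1 hj).2
      rw [hK.update_eq i j hji, hχ j hji, ha]
      congr 2
      refine Finset.prod_congr rfl fun k hk => hK.update_eq k j (fun hjk => hji ?_) y b
      exact hjk.trans (Finset.mem_filter.1 (Finset.mem_of_mem_erase hk)).2
  rw [split φ hφ, split ψ (fun j hj => hψ j fun hlt => hj hlt.le)]
  congr 1
  refine sum_mul_congr_of_sum_update (e i) _ _ _ ?_ ?_
  · intro y b
    rw [ha]
    congr 1
    refine Finset.prod_congr rfl fun k hk => hK.update_eq k i (fun hik => ?_) y b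
    obtain ⟨hki, hk⟩ := Finset.mem_erase.1 hk
    exact hki (le_antisymm (Finset.mem_filter.1 hk).2 hik)
  · intro y
    rw [h y]
    simp only [hψ i (lt_irrefl i)]
    rw [← Finset.sum_mul, hK.sum_update, one_mul]

end Causal

/-! ### Conditional mutual information of a channel with side information -/

section Info

variable {A B C : Type*} [Fintype A] [Fintype B] [Fintype C]

/-- The joint law of an input `a`, an output `b` and a state `c`, when `(a, c)` has the law `p` and
`W` is the conditional law of the output. -/
def chanJoint (W : A → C → stdSimplex ℝ B) (p : A × C → ℝ) : A → B → C → ℝ :=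
  fun a b c => (W a c).1 b * p (a, c)

/-- The marginal at output and state. -/
def chanOut (W : A → C → stdSimplex ℝ B) (p : A × C → ℝ) (b : B) (c : C) : ℝ :=
  ∑ a, chanJoint W p a b c

/-- The marginal at the state. -/
def stateMarg (p : A × C → ℝ) (c : C) : ℝ := ∑ a, p (a, c)

open scoped Classical in
/-- The conditional law of the output given the state. At states of probability zero it is the
uniform law. -/
def condOut (W : A → C → stdSimplex ℝ B) (p : A × C → ℝ) (b : B) (c : C) : ℝ :=
  if stateMarg p c = 0 then (Fintype.card B : ℝ)⁻¹ else chanOut W p b c / stateMarg p c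

variable (W : A → C → stdSimplex ℝ B) {p q : A × C → ℝ}

theorem sum_chanJoint_out (p : A × C → ℝ) (a : A) (c : C) :
    ∑ b, chanJoint W p a b c = p (a, c) := by
  simp only [chanJoint, ← Finset.sum_mul, (W a c).2.2, one_mul]

theorem sum_chanOut (p : A × C → ℝ) (c : C) : ∑ b, chanOut W p b c = stateMarg p c := by
  simp only [chanOut, stateMarg]
  rw [Finset.sum_comm]
  exact Finset.sum_congr rfl fun a _ => sum_chanJoint_out W p a c

theorem chanJoint_nonneg (hp : ∀ z, 0 ≤ p z) (a : A) (b : B) (c : C) : 0 ≤ chanJoint W p a b c :=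
  mul_nonneg ((W a c).2.1 b) (hp _)

theorem chanOut_nonneg (hp : ∀ z, 0 ≤ p z) (b : B) (c : C) : 0 ≤ chanOut W p b c :=
  Finset.sum_nonneg fun a _ => chanJoint_nonneg W hp a b c

theorem stateMarg_nonneg (hp : ∀ z, 0 ≤ p z) (c : C) : 0 ≤ stateMarg p c :=
  Finset.sum_nonneg fun _ _ => hp _

theorem le_stateMarg (hp : ∀ z, 0 ≤ p z) (a : A) (c : C) : p (a, c) ≤ stateMarg p c :=
  Finset.single_le_sum (f := fun a => p (a, c)) (fun _ _ => hp _) (Finset.mem_univ a)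

theorem chanJoint_le_chanOut (hp : ∀ z, 0 ≤ p z) (a : A) (b : B) (c : C) :
    chanJoint W p a b c ≤ chanOut W p b c :=
  Finset.single_le_sum (f := fun a => chanJoint W p a b c)
    (fun _ _ => chanJoint_nonneg W hp _ _ _) (Finset.mem_univ a)

theorem chanOut_le_stateMarg (hp : ∀ z, 0 ≤ p z) (b : B) (c : C) :
    chanOut W p b c ≤ stateMarg p c := by
  rw [← sum_chanOut W p c]
  exact Finset.single_le_sum (f := fun b => chanOut W p b c)
    (fun _ _ => chanOut_nonneg W hp _ _) (Finset.mem_univ b)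

theorem chanOut_eq_zero (hp : ∀ z, 0 ≤ p z) {c : C} (h : stateMarg p c = 0) (b : B) :
    chanOut W p b c = 0 :=
  le_antisymm (h ▸ chanOut_le_stateMarg W hp b c) (chanOut_nonneg W hp b c)

theorem condOut_nonneg (hp : ∀ z, 0 ≤ p z) (b : B) (c : C) : 0 ≤ condOut W p b c := by
  unfold condOut
  split_ifs
  · positivity
  · exact div_nonneg (chanOut_nonneg W hp b c) (stateMarg_nonneg hp c)

theorem sum_condOut [Nonempty B] (p : A × C → ℝ) (c : C) : ∑ b, condOut W p b c = 1 := by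
  unfold condOut
  split_ifs with h
  · simp
  · rw [← Finset.sum_div, sum_chanOut, div_self h]

theorem condOut_ne_zero (hp : ∀ z, 0 ≤ p z) {a : A} {b : B} {c : C}
    (h : chanJoint W p a b c ≠ 0) : condOut W p b c ≠ 0 := by
  have h1 : 0 < chanJoint W p a b c := (chanJoint_nonneg W hp a b c).lt_of_ne' h
  have h2 := h1.trans_le (chanJoint_le_chanOut W hp a b c)
  have h3 := h2.trans_le (chanOut_le_stateMarg W hp b c)
  rw [condOut, if_neg h3.ne']
  exact (div_pos h2 h3).ne'

/-- The conditional mutual information is the mean of the logarithm of the ratio of the channel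
law to the conditional law of the output given the state. -/
theorem condMutualInfo_chanJoint (hp : ∀ z, 0 ≤ p z) :
    condMutualInfo (chanJoint W p) =
      ∑ a, ∑ b, ∑ c, chanJoint W p a b c * Real.log ((W a c).1 b / condOut W p b c) := by
  unfold condMutualInfo
  refine Finset.sum_congr rfl fun a _ => Finset.sum_congr rfl fun b _ =>
    Finset.sum_congr rfl fun c _ => ?_
  rcases eq_or_ne (chanJoint W p a b c) 0 with h | h
  · rw [h, zero_mul, zero_mul]
  have hp0 : p (a, c) ≠ 0 := fun h0 => h (by simp [chanJoint, h0])
  have hs : stateMarg p c ≠ 0 :=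
    (((hp _).lt_of_ne' hp0).trans_le (le_stateMarg hp a c)).ne'
  simp only [sum_chanJoint_out]
  rw [condOut, if_neg hs]
  congr 2
  change (W a c).1 b * p (a, c) * stateMarg p c / (p (a, c) * chanOut W p b c) = _
  field_simp

theorem condMutualInfo_eq_sub (hp : ∀ z, 0 ≤ p z) :
    condMutualInfo (chanJoint W p) =
      (∑ a, ∑ b, ∑ c, p (a, c) * -Real.negMulLog ((W a c).1 b)) -
        ∑ b, ∑ c, chanOut W p b c * Real.log (chanOut W p b c / stateMarg p c) := by
  have h : ∀ b c, chanOut W p b c * Real.log (chanOut W p b c / stateMarg p c) =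
      ∑ a, chanJoint W p a b c * Real.log (condOut W p b c) := by
    intro b c
    rw [← Finset.sum_mul]
    change _ = chanOut W p b c * _
    unfold condOut
    split_ifs with hs
    · rw [chanOut_eq_zero W hp hs, zero_mul, zero_mul]
    · rfl
  simp only [condMutualInfo_chanJoint W hp, h]
  have h2 : ∀ f : B → C → A → ℝ, ∑ b, ∑ c, ∑ a, f b c a = ∑ a, ∑ b, ∑ c, f b c a := by
    intro f
    rw [Finset.sum_comm' (t' := Finset.univ) (s' := fun _ => Finset.univ) (by simp)]
    simp only [Finset.sum_comm (s := (Finset.univ : Finset B)) (t := (Finset.univ : Finset A))]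
    rw [Finset.sum_comm]
    refine Finset.sum_congr rfl fun a _ => ?_
    rw [Finset.sum_comm]
  rw [h2]
  simp only [← Finset.sum_sub_distrib]
  refine Finset.sum_congr rfl fun a _ => Finset.sum_congr rfl fun b _ =>
    Finset.sum_congr rfl fun c _ => ?_
  rcases eq_or_ne (chanJoint W p a b c) 0 with h0 | h0
  · rw [h0, zero_mul, zero_mul, sub_zero]
    rcases mul_eq_zero.1 h0 with h0 | h0
    · rw [h0]; simp
    · rw [h0]; simp
  · rw [Real.log_div (left_ne_zero_of_mul h0) (condOut_ne_zero W hp h0)]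
    simp only [chanJoint, Real.negMulLog]
    ring

theorem continuousOn_condMutualInfo_chanJoint :
    ContinuousOn (fun p : A × C → ℝ => condMutualInfo (chanJoint W p)) {p | ∀ z, 0 ≤ p z} := by
  have h : ∀ p ∈ {p : A × C → ℝ | ∀ z, 0 ≤ p z}, condMutualInfo (chanJoint W p) =
      (∑ a, ∑ b, ∑ c, p (a, c) * -Real.negMulLog ((W a c).1 b)) -
        ((∑ b, ∑ c, -Real.negMulLog (chanOut W p b c)) -
          ∑ c, -Real.negMulLog (stateMarg p c)) := by
    intro p hp
    rw [condMutualInfo_eq_sub W hp]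
    congr 1
    have h1 : ∀ c, -Real.negMulLog (stateMarg p c) =
        ∑ b, chanOut W p b c * Real.log (stateMarg p c) := by
      intro c
      rw [← Finset.sum_mul, sum_chanOut]
      simp [Real.negMulLog]
    simp only [h1]
    rw [Finset.sum_comm (s := (Finset.univ : Finset C))]
    simp only [← Finset.sum_sub_distrib]
    refine Finset.sum_congr rfl fun b _ => Finset.sum_congr rfl fun c _ => ?_
    rcases eq_or_ne (chanOut W p b c) 0 with h0 | h0
    · simp [h0]
    · have hs : stateMarg p c ≠ 0 := fun hs => h0 (chanOut_eq_zero W hp hs b)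
      rw [Real.log_div h0 hs, Real.negMulLog]
      ring
  refine ContinuousOn.congr (Continuous.continuousOn ?_) h
  unfold chanOut stateMarg chanJoint
  have := Real.continuous_negMulLog
  fun_prop

/-- Conditional mutual information is concave in the law of input and state, by the log-sum
inequality. -/
theorem condMutualInfo_chanJoint_concave (hp : ∀ z, 0 ≤ p z) (hq : ∀ z, 0 ≤ q z) {s t : ℝ}
    (hs : 0 ≤ s) (ht : 0 ≤ t) :
    s * condMutualInfo (chanJoint W p) + t * condMutualInfo (chanJoint W q) ≤
      condMutualInfo (chanJoint W (s • p + t • q)) := by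
  have hpq : ∀ z, 0 ≤ (s • p + t • q) z := fun z =>
    add_nonneg (mul_nonneg hs (hp z)) (mul_nonneg ht (hq z))
  have hout : ∀ b c, chanOut W (s • p + t • q) b c = s * chanOut W p b c + t * chanOut W q b c := by
    intro b c
    simp only [chanOut, chanJoint, Finset.mul_sum, ← Finset.sum_add_distrib]
    refine Finset.sum_congr rfl fun a _ => ?_
    simp only [Pi.add_apply, Pi.smul_apply, smul_eq_mul]
    ring
  have hstate : ∀ c, stateMarg (s • p + t • q) c = s * stateMarg p c + t * stateMarg q c := by
    intro c
    simp only [stateMarg, Finset.mul_sum, ← Finset.sum_add_distrib]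
    rfl
  have hscale : ∀ {r : ℝ} (x y : ℝ), r * x * Real.log (r * x / (r * y)) =
      r * (x * Real.log (x / y)) := by
    intro r x y
    rcases eq_or_ne r 0 with rfl | hr
    · simp
    · rw [mul_div_mul_left _ _ hr, mul_assoc]
  have hlog : ∀ b c,
      chanOut W (s • p + t • q) b c *
        Real.log (chanOut W (s • p + t • q) b c / stateMarg (s • p + t • q) c) ≤
      s * (chanOut W p b c * Real.log (chanOut W p b c / stateMarg p c)) +
        t * (chanOut W q b c * Real.log (chanOut W q b c / stateMarg q c)) := by
    intro b c
    rw [hout, hstate, ← hscale, ← hscale]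
    refine add_mul_log_div_add_le (mul_nonneg hs (chanOut_nonneg W hp b c))
      (mul_nonneg ht (chanOut_nonneg W hq b c)) (mul_nonneg hs (stateMarg_nonneg hp c))
      (mul_nonneg ht (stateMarg_nonneg hq c)) ?_ ?_
    · intro h
      rcases mul_eq_zero.1 h with h | h
      · rw [h, zero_mul]
      · rw [chanOut_eq_zero W hp h, mul_zero]
    · intro h
      rcases mul_eq_zero.1 h with h | h
      · rw [h, zero_mul]
      · rw [chanOut_eq_zero W hq h, mul_zero]
  have hsum := Finset.sum_le_sum fun b (_ : b ∈ (Finset.univ : Finset B)) =>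
    Finset.sum_le_sum fun c (_ : c ∈ (Finset.univ : Finset C)) => hlog b c
  simp only [Finset.sum_add_distrib, ← Finset.mul_sum] at hsum
  have hlin : (∑ a, ∑ b, ∑ c, (s • p + t • q) (a, c) * -Real.negMulLog ((W a c).1 b)) =
      s * (∑ a, ∑ b, ∑ c, p (a, c) * -Real.negMulLog ((W a c).1 b)) +
        t * (∑ a, ∑ b, ∑ c, q (a, c) * -Real.negMulLog ((W a c).1 b)) := by
    simp only [Finset.mul_sum, ← Finset.sum_add_distrib]
    refine Finset.sum_congr rfl fun a _ => Finset.sum_congr rfl fun b _ =>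
      Finset.sum_congr rfl fun c _ => ?_
    simp only [Pi.add_apply, Pi.smul_apply, smul_eq_mul]
    ring
  rw [condMutualInfo_eq_sub W hp, condMutualInfo_eq_sub W hq, condMutualInfo_eq_sub W hpq, hlin]
  linarith

end Info

/-! ### The program: convexity, concavity, compactness -/

namespace PosetMarkovChannel

variable {V X Y : Type*} [PartialOrder V] [Fintype X] [Fintype Y] [MeasurableSpace Y]
  (ch : PosetMarkovChannel V X Y)

theorem localJoint_eq (v : ch.comm) (p : X × (ch.Pa v → Y) → ℝ) :
    ch.localJoint v p = chanJoint (ch.localLaw v) p := rfl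

variable {ch}

theorem nonneg_of_mem_feasible {n : ℕ} {P : ch.LocalVars n} (hP : P ∈ ch.feasible n)
    (v : ch.CommNode n) (z : X × (ch.Pa v.1 → Y)) : 0 ≤ P v z :=
  (hP.1 v).1 z

variable (ch)

theorem convex_feasible (n : ℕ) : Convex ℝ (ch.feasible n) := by
  classical
  intro P hP Q hQ s t hs ht hst
  refine ⟨fun v => convex_stdSimplex ℝ _ (hP.1 v) (hQ.1 v) hs ht hst, fun u v h b => ?_,
    fun u v z => ?_⟩
  · have h1 := congrArg₂ (fun x y => s * x + t * y) (hP.2.1 u v h b) (hQ.2.1 u v h b)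
    simp only [localJoint, Finset.mul_sum, ← Finset.sum_add_distrib] at h1 ⊢
    convert h1 using 4
    · simp only [Pi.add_apply, Pi.smul_apply, smul_eq_mul]
      split_ifs <;> ring
    · simp only [Pi.add_apply, Pi.smul_apply, smul_eq_mul]
      ring
  · have h1 := congrArg₂ (fun x y => s * x + t * y) (hP.2.2 u v z) (hQ.2.2 u v z)
    simp only [Finset.mul_sum, ← Finset.sum_add_distrib] at h1 ⊢
    convert h1 using 4 <;>
    · simp only [Pi.add_apply, Pi.smul_apply, smul_eq_mul]
      split_ifs <;> ring

theorem concaveOn_objective (n : ℕ) : ConcaveOn ℝ (ch.feasible n) (ch.objective n) := by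
  refine ⟨ch.convex_feasible n, fun P hP Q hQ s t hs ht _ => ?_⟩
  simp only [objective, smul_eq_mul, localJoint_eq]
  have h := Finset.sum_le_sum fun v (_ : v ∈ (Finset.univ : Finset (ch.CommNode n))) =>
    condMutualInfo_chanJoint_concave (ch.localLaw v.1) (nonneg_of_mem_feasible hP v)
      (nonneg_of_mem_feasible hQ v) hs ht
  simp only [Finset.sum_add_distrib, ← Finset.mul_sum] at h
  have h2 := mul_le_mul_of_nonneg_left h (by positivity : 0 ≤ 1 / (ch.numComm n : ℝ))
  refine le_trans (le_of_eq ?_) h2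
  ring

theorem isCompact_feasible (n : ℕ) : IsCompact (ch.feasible n) := by
  classical
  have hc : IsCompact (Set.univ.pi fun v : ch.CommNode n =>
      stdSimplex ℝ (X × (ch.Pa v.1 → Y))) :=
    isCompact_univ_pi fun v => isCompact_stdSimplex ℝ _
  refine hc.of_isClosed_subset ?_ fun P hP v _ => hP.1 v
  have h1 : ∀ (v : ch.CommNode n) (z : X × (ch.Pa v.1 → Y)),
      Continuous fun P : ch.LocalVars n => P v z := fun v z => by fun_prop
  have h2 : ∀ (v : ch.CommNode n) (c : Prop) [Decidable c] (z : X × (ch.Pa v.1 → Y)),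
      Continuous fun P : ch.LocalVars n => if c then P v z else 0 := by
    intro v c _ z
    split_ifs
    · exact h1 v z
    · exact continuous_const
  refine IsClosed.and ?_ (IsClosed.and ?_ ?_)
  · simp only [Set.ofPred_forall]
    exact isClosed_iInter fun v => (isClosed_stdSimplex ℝ _).preimage (continuous_apply v)
  · simp only [Set.ofPred_forall]
    refine isClosed_iInter fun u => isClosed_iInter fun v => isClosed_iInter fun h =>
      isClosed_iInter fun b => isClosed_eq ?_ ?_
    · exact continuous_finsetSum _ fun x _ => continuous_finsetSum _ fun y _ => h2 u _ _
    · exact continuous_finsetSum _ fun x _ => continuous_finsetSum _ fun y _ =>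
        continuous_const.mul (h1 v _)
  · simp only [Set.ofPred_forall]
    refine isClosed_iInter fun u => isClosed_iInter fun v => isClosed_iInter fun z =>
      isClosed_eq ?_ ?_ <;>
    exact continuous_finsetSum _ fun x _ => continuous_finsetSum _ fun y _ => h2 _ _ _

theorem continuousOn_objective (n : ℕ) : ContinuousOn (ch.objective n) (ch.feasible n) := by
  refine continuousOn_const.mul (continuousOn_finsetSum _ fun v _ => ?_)
  exact (continuousOn_condMutualInfo_chanJoint (ch.localLaw v.1)).comp
    (continuous_apply v).continuousOn fun P hP => nonneg_of_mem_feasible hP v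

theorem isGreatest_programValue {n : ℕ} (hne : (ch.feasible n).Nonempty) :
    IsGreatest (ch.objective n '' ch.feasible n) (ch.programValue n) :=
  ((ch.isCompact_feasible n).image_of_continuousOn (ch.continuousOn_objective n)).isGreatest_sSup
    (hne.image _)

end PosetMarkovChannel

/-! ### The outputs of the initial nodes -/

namespace PosetCausalChannel

variable {V X Y : Type*} [PartialOrder V] [Fintype Y] [MeasurableSpace Y]
  (ch : PosetCausalChannel V X Y)

theorem initProb_nonneg {n : ℕ} (y : ch.nodes n → Y) : 0 ≤ ch.initProb y :=
  measureReal_nonneg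

/-- The initial probabilities depend on the outputs of the initial nodes only. -/
theorem initProb_congr {n : ℕ} {y y' : ch.nodes n → Y} (h : ∀ v, v.1 ∉ ch.comm → y v = y' v) :
    ch.initProb y = ch.initProb y' := by
  unfold initProb
  congr 1
  ext z
  refine forall_congr' fun i => forall_congr' fun hi => ?_
  rw [h ⟨i.1, hi⟩ i.2]

open scoped Classical in
theorem card_agree_init (n : ℕ) (z : {v : V // v ∉ ch.comm} → Y) :
    (Finset.univ.filter fun y : ch.nodes n → Y =>
      ∀ (i : {v : V // v ∉ ch.comm}) (h : i.1 ∈ ch.nodes n), z i = y ⟨i.1, h⟩).card =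
      Fintype.card Y ^ ch.numComm n := by
  have h1 : (Finset.univ.filter fun y : ch.nodes n → Y =>
      ∀ (i : {v : V // v ∉ ch.comm}) (h : i.1 ∈ ch.nodes n), z i = y ⟨i.1, h⟩) =
      Fintype.piFinset fun v : ch.nodes n =>
        if h : v.1 ∈ ch.comm then Finset.univ else {z ⟨v.1, h⟩} := by
    ext y
    simp only [Finset.mem_filter, Finset.mem_univ, true_and, Fintype.mem_piFinset]
    constructor
    · intro h v
      split_ifs with hv
      · exact Finset.mem_univ _
      · exact Finset.mem_singleton.2 (h ⟨v.1, hv⟩ v.2).symm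
    · intro h i hi
      have := h ⟨i.1, hi⟩
      rw [dif_neg i.2] at this
      exact (Finset.mem_singleton.1 this).symm
  rw [h1, Fintype.card_piFinset]
  have h2 : ∀ v : ch.nodes n,
      (if h : v.1 ∈ ch.comm then (Finset.univ : Finset Y) else {z ⟨v.1, h⟩}).card =
        if v.1 ∈ ch.comm then Fintype.card Y else 1 := by
    intro v
    split_ifs <;> simp
  simp only [h2]
  rw [Finset.prod_ite, Finset.prod_const, Finset.prod_const_one, mul_one, numComm,
    ← Fintype.card_subtype]
  congr 1
  exact Fintype.card_congr
    { toFun := fun v => ⟨⟨v.1.1, v.2⟩, v.1.2⟩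
      invFun := fun v => ⟨⟨v.1.1, v.2⟩, v.1.2⟩
      left_inv := fun _ => rfl
      right_inv := fun _ => rfl }

open scoped Classical in
/-- Every outcome of the initial nodes is counted once for each choice of the outputs of the
communication nodes. -/
theorem sum_initProb [MeasurableSingletonClass Y] (n : ℕ) :
    ∑ y : ch.nodes n → Y, ch.initProb y = (Fintype.card Y : ℝ) ^ ch.numComm n := by
  let S : (ch.nodes n → Y) → Set ({v : V // v ∉ ch.comm} → Y) := fun y =>
    {z | ∀ (i : {v : V // v ∉ ch.comm}) (h : i.1 ∈ ch.nodes n), z i = y ⟨i.1, h⟩}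
  have hS : ∀ y, MeasurableSet (S y) := by
    intro y
    have : S y = ⋂ j : {v : ch.nodes n // v.1 ∉ ch.comm},
        (fun z : {v : V // v ∉ ch.comm} → Y => z ⟨j.1.1, j.2⟩) ⁻¹' {y j.1} := by
      ext z
      simp only [Set.mem_iInter, Set.mem_preimage, Set.mem_singleton_iff]
      exact ⟨fun h j => h ⟨j.1.1, j.2⟩ j.1.2, fun h i hi => h ⟨⟨i.1, hi⟩, i.2⟩⟩
    rw [this]
    exact MeasurableSet.iInter fun j => measurable_pi_apply _ (measurableSet_singleton _)
  have h1 : ∀ y, ch.initProb y =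
      ∫ z, (S y).indicator (fun _ => (1 : ℝ)) z
        ∂(ch.init : Measure ({v : V // v ∉ ch.comm} → Y)) := fun y =>
    (integral_indicator_one (hS y)).symm
  simp only [h1]
  rw [← integral_finsetSum _ fun y _ => (integrable_const (1 : ℝ)).indicator (hS y)]
  have h2 : ∀ z, ∑ y, (S y).indicator (fun _ => (1 : ℝ)) z =
      (Fintype.card Y : ℝ) ^ ch.numComm n := by
    intro z
    rw [← Nat.cast_pow, ← ch.card_agree_init n z, Finset.card_filter, Nat.cast_sum]
    refine Finset.sum_congr rfl fun y _ => ?_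
    simp [Set.indicator_apply, S]
  simp [h2]

end PosetCausalChannel

/-! ### Expectations under a code -/

namespace PosetMarkovChannel

open scoped Classical

variable {V X Y : Type*} [PartialOrder V] [Fintype X] [Fintype Y] [MeasurableSpace Y]
  (ch : PosetMarkovChannel V X Y) {n M : ℕ}

/-- The outputs of the parents of `v`. -/
def paOut (v : ch.CommNode n) (y : ch.nodes n → Y) : ch.Pa v.1 → Y :=
  fun w => y ⟨w.1, ch.nodes_lower n v.1 w.1 v.2
    ((ch.lt_iff_path w.1 v.1).2 (Relation.TransGen.single w.2))⟩

/-- The input at `v` for the message `m`. -/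
def inputAt (f : ch.Encoder n M) (m : Fin M) (v : ch.CommNode n) (y : ch.nodes n → Y) : X :=
  f v m (ch.past y v.1 v.2)

/-- A communication node, as a coordinate of the outputs of the first `n` stages. -/
def coord (v : ch.CommNode n) : ch.nodes n := ⟨v.1, v.2⟩

/-- The factor that the node `v` contributes to the law of the outputs. -/
def kernel (f : ch.Encoder n M) (m : Fin M) (v : ch.CommNode n) (y : ch.nodes n → Y) : ℝ :=
  (ch.localLaw v.1 (ch.inputAt f m v y) (ch.paOut v y)).1 (y (ch.coord v))

theorem outputProb_eq (f : ch.Encoder n M) (m : Fin M) (y : ch.nodes n → Y) :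
    ch.outputProb f m y = ch.initProb y * ∏ v, ch.kernel f m v y := by
  unfold PosetCausalChannel.outputProb
  congr 1
  refine Finset.prod_congr rfl fun v _ => ?_
  rw [ch.markov]
  rfl

theorem kernel_nonneg (f : ch.Encoder n M) (m : Fin M) (v : ch.CommNode n) (y : ch.nodes n → Y) :
    0 ≤ ch.kernel f m v y :=
  (ch.localLaw v.1 _ _).2.1 _

theorem outputProb_nonneg (f : ch.Encoder n M) (m : Fin M) (y : ch.nodes n → Y) :
    0 ≤ ch.outputProb f m y := by
  rw [outputProb_eq]
  exact mul_nonneg (ch.initProb_nonneg y) (Finset.prod_nonneg fun v _ => ch.kernel_nonneg f m v y)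

theorem past_update {v u : ch.CommNode n} (h : ¬ u < v) (y : ch.nodes n → Y) (b : Y) :
    ch.past (Function.update y (ch.coord u) b) v.1 v.2 = ch.past y v.1 v.2 := by
  funext w
  refine Function.update_of_ne (fun hw => h ?_) _ _
  have h1 : w.1 = (u.1 : V) := congrArg Subtype.val hw
  change (u.1 : V) < v.1
  rw [← h1]
  exact w.2

theorem paOut_update {v u : ch.CommNode n} (h : ¬ u < v) (y : ch.nodes n → Y) (b : Y) :
    ch.paOut v (Function.update y (ch.coord u) b) = ch.paOut v y := by
  funext w
  exact congrFun (ch.past_update h y b)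
    ⟨w.1, (ch.lt_iff_path w.1 v.1).2 (Relation.TransGen.single w.2)⟩

theorem inputAt_update (f : ch.Encoder n M) (m : Fin M) {v u : ch.CommNode n} (h : ¬ u < v)
    (y : ch.nodes n → Y) (b : Y) :
    ch.inputAt f m v (Function.update y (ch.coord u) b) = ch.inputAt f m v y := by
  unfold inputAt
  rw [ch.past_update h]

theorem coord_update_of_ne {v u : ch.CommNode n} (h : u ≠ v) (y : ch.nodes n → Y) (b : Y) :
    Function.update y (ch.coord u) b (ch.coord v) = y (ch.coord v) := by
  refine Function.update_of_ne (fun hw => h ?_) _ _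
  have h1 : (v.1 : V) = u.1 := congrArg (fun t : ch.nodes n => (t : V)) hw
  exact Subtype.ext (Subtype.ext h1.symm)

theorem initProb_update (u : ch.CommNode n) (y : ch.nodes n → Y) (b : Y) :
    ch.initProb (Function.update y (ch.coord u) b) = ch.initProb y := by
  refine ch.initProb_congr fun v hv => Function.update_of_ne (fun h => hv ?_) _ _
  rw [h]
  exact u.1.2

theorem isCausalKernel_kernel (f : ch.Encoder n M) (m : Fin M) :
    IsCausalKernel ch.coord (ch.kernel f m) where
  update_eq v u h y b := by
    have hlt : ¬ u < v := fun h' => h h'.le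
    have hne : u ≠ v := fun h' => h h'.le
    simp only [kernel, ch.inputAt_update f m hlt, ch.paOut_update hlt, ch.coord_update_of_ne hne]
  sum_update v y := by
    simp only [kernel, ch.inputAt_update f m (lt_irrefl v), ch.paOut_update (lt_irrefl v),
      Function.update_self]
    exact (ch.localLaw v.1 _ _).2.2

theorem isCausalKernel_of_paOut (r : (v : ch.CommNode n) → Y → (ch.Pa v.1 → Y) → ℝ)
    (hr : ∀ v t, ∑ b, r v b t = 1) :
    IsCausalKernel ch.coord fun v y => r v (y (ch.coord v)) (ch.paOut v y) where
  update_eq v u h y b := by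
    have hlt : ¬ u < v := fun h' => h h'.le
    have hne : u ≠ v := fun h' => h h'.le
    simp only [ch.paOut_update hlt, ch.coord_update_of_ne hne]
  sum_update v y := by
    simp only [ch.paOut_update (lt_irrefl v), Function.update_self, hr]

/-- An initial law and causal kernels make up a probability law. -/
theorem sum_initProb_mul_prod [MeasurableSingletonClass Y] [Nonempty Y]
    {K : ch.CommNode n → (ch.nodes n → Y) → ℝ} (hK : IsCausalKernel ch.coord K) :
    ∑ y, ch.initProb y * ∏ v, K v y = 1 := by
  rw [hK.sum_mul_prod Finset.univ _ fun v _ y b => ch.initProb_update v y b, ch.sum_initProb,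
    Finset.card_univ, inv_pow]
  exact inv_mul_cancel₀ (pow_ne_zero _ (Nat.cast_ne_zero.2 Fintype.card_ne_zero))

/-- The expectation of a function of the message and of the outputs of the first `n` stages, for a
uniform message and the encoder `f`. -/
def codeExp (f : ch.Encoder n M) (G : Fin M → (ch.nodes n → Y) → ℝ) : ℝ :=
  (1 / (M : ℝ)) * ∑ m, ∑ y, ch.outputProb f m y * G m y

variable (f : ch.Encoder n M)

theorem codeExp_sum {ι : Type*} (s : Finset ι) (G : ι → Fin M → (ch.nodes n → Y) → ℝ) :
    ch.codeExp f (fun m y => ∑ i ∈ s, G i m y) = ∑ i ∈ s, ch.codeExp f (G i) := by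
  simp only [codeExp, Finset.mul_sum]
  rw [Finset.sum_comm]
  conv_lhs =>
    enter [2, y]
    rw [Finset.sum_comm]
  rw [Finset.sum_comm]
  refine Finset.sum_congr rfl fun i _ => ?_
  rw [Finset.sum_comm]

theorem codeExp_mul_const (G : Fin M → (ch.nodes n → Y) → ℝ) (c : ℝ) :
    ch.codeExp f (fun m y => G m y * c) = ch.codeExp f G * c := by
  simp only [codeExp, mul_assoc, Finset.sum_mul]

theorem codeExp_nonneg {G : Fin M → (ch.nodes n → Y) → ℝ} (hG : ∀ m y, 0 ≤ G m y) :
    0 ≤ ch.codeExp f G :=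
  mul_nonneg (by positivity) (Finset.sum_nonneg fun m _ => Finset.sum_nonneg fun y _ =>
    mul_nonneg (ch.outputProb_nonneg f m y) (hG m y))

theorem sum_outputProb [MeasurableSingletonClass Y] [Nonempty Y] (m : Fin M) :
    ∑ y, ch.outputProb f m y = 1 := by
  simp only [outputProb_eq]
  exact ch.sum_initProb_mul_prod (ch.isCausalKernel_kernel f m)

theorem codeExp_const [MeasurableSingletonClass Y] [Nonempty Y] (hM : 1 ≤ M) (c : ℝ) :
    ch.codeExp f (fun _ _ => c) = c := by
  have hM0 : (M : ℝ) ≠ 0 := Nat.cast_ne_zero.2 (by omega)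
  simp only [codeExp, ← Finset.sum_mul, ch.sum_outputProb f]
  simp only [Finset.sum_const, Finset.card_univ, Fintype.card_fin, nsmul_eq_mul]
  field_simp

/-- The channel law at `v`: given the message and the outputs before `v`, the output at `v` has
the law that the channel prescribes for the current input and the outputs of the parents. -/
theorem codeExp_output [Nonempty Y] (v : ch.CommNode n) (φ : X → Y → (ch.Pa v.1 → Y) → ℝ) :
    ch.codeExp f (fun m y => φ (ch.inputAt f m v y) (y (ch.coord v)) (ch.paOut v y)) =
      ch.codeExp f (fun m y => ∑ b, (ch.localLaw v.1 (ch.inputAt f m v y) (ch.paOut v y)).1 b *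
        φ (ch.inputAt f m v y) b (ch.paOut v y)) := by
  unfold codeExp
  congr 1
  refine Finset.sum_congr rfl fun m _ => ?_
  simp only [outputProb_eq]
  refine (ch.isCausalKernel_kernel f m).sum_mul_prod_mul v _ _ _
    (fun u y b => ch.initProb_update u y b) ?_ ?_ ?_
  · intro u h y b
    have hlt : ¬ u < v := fun h' => h h'.le
    have hne : u ≠ v := fun h' => h h'.le
    simp only [ch.inputAt_update f m hlt, ch.paOut_update hlt, ch.coord_update_of_ne hne]
  · intro u h y b
    simp only [ch.inputAt_update f m h, ch.paOut_update h]
  · intro y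
    simp only [kernel, ch.inputAt_update f m (lt_irrefl v), ch.paOut_update (lt_irrefl v),
      Function.update_self]

/-- The joint law of the input at `v` and the outputs of the parents of `v` under a code. -/
def inducedLaw : ch.LocalVars n := fun v z =>
  ch.codeExp f (fun m y => if ch.inputAt f m v y = z.1 ∧ ch.paOut v y = z.2 then 1 else 0)

theorem inducedLaw_nonneg (v : ch.CommNode n) (z : X × (ch.Pa v.1 → Y)) :
    0 ≤ ch.inducedLaw f v z :=
  ch.codeExp_nonneg f fun m y => by split_ifs <;> norm_num

theorem sum_inducedLaw_mul (v : ch.CommNode n) (φ : X → (ch.Pa v.1 → Y) → ℝ) :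
    ∑ x, ∑ t, ch.inducedLaw f v (x, t) * φ x t =
      ch.codeExp f (fun m y => φ (ch.inputAt f m v y) (ch.paOut v y)) := by
  simp only [inducedLaw, ← codeExp_mul_const, ← codeExp_sum]
  congr 1
  funext m y
  rw [Finset.sum_eq_single (ch.inputAt f m v y) _ (by simp),
    Finset.sum_eq_single (ch.paOut v y) _ (by simp)]
  · simp
  · intro t _ ht
    simp [ht.symm]
  · intro x _ hx
    simp [hx.symm]

/-- The joint law at `v` that the program assigns to the induced law is the true one. -/
theorem sum_localJoint_inducedLaw_mul [Nonempty Y] (v : ch.CommNode n)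
    (φ : X → Y → (ch.Pa v.1 → Y) → ℝ) :
    ∑ x, ∑ b, ∑ t, ch.localJoint v.1 (ch.inducedLaw f v) x b t * φ x b t =
      ch.codeExp f (fun m y => φ (ch.inputAt f m v y) (y (ch.coord v)) (ch.paOut v y)) := by
  rw [codeExp_output, ← ch.sum_inducedLaw_mul f v
    (fun x t => ∑ b, (ch.localLaw v.1 x t).1 b * φ x b t)]
  refine Finset.sum_congr rfl fun x _ => ?_
  rw [Finset.sum_comm]
  refine Finset.sum_congr rfl fun t _ => ?_
  rw [Finset.mul_sum]
  refine Finset.sum_congr rfl fun b _ => ?_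
  simp only [localJoint]
  ring

theorem inducedLaw_mem_feasible [MeasurableSingletonClass Y] [Nonempty Y] (hM : 1 ≤ M) :
    ch.inducedLaw f ∈ ch.feasible n := by
  refine ⟨fun v => ⟨ch.inducedLaw_nonneg f v, ?_⟩, fun u v h b => ?_, fun u v z => ?_⟩
  · have := ch.sum_inducedLaw_mul f v (fun _ _ => 1)
    rw [ch.codeExp_const f hM] at this
    rw [Fintype.sum_prod_type]
    simpa using this
  · have h1 := ch.sum_inducedLaw_mul f u (fun _ t => if t ⟨v.1, h⟩ = b then 1 else 0)
    have h2 := ch.sum_localJoint_inducedLaw_mul f v (fun _ b' _ => if b' = b then 1 else 0)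
    simp only [mul_ite, mul_one, mul_zero] at h1 h2
    rw [h1]
    have h3 : ∀ y, ch.paOut u y ⟨v.1, h⟩ = y (ch.coord v) := fun y => rfl
    simp only [h3]
    rw [← h2]
    refine Finset.sum_congr rfl fun x _ => ?_
    rw [Finset.sum_comm]
    refine Finset.sum_congr rfl fun t _ => ?_
    simp
  · have h1 := ch.sum_inducedLaw_mul f u
      (fun _ t => if ∀ w : {w : V // ch.edge w u.1 ∧ ch.edge w v.1},
        t ⟨w.1, w.2.1⟩ = z w then 1 else 0)
    have h2 := ch.sum_inducedLaw_mul f v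
      (fun _ t => if ∀ w : {w : V // ch.edge w u.1 ∧ ch.edge w v.1},
        t ⟨w.1, w.2.2⟩ = z w then 1 else 0)
    simp only [mul_ite, mul_one, mul_zero] at h1 h2
    have h3 : ∀ (y : ch.nodes n → Y) (w : {w : V // ch.edge w u.1 ∧ ch.edge w v.1}),
        ch.paOut u y ⟨w.1, w.2.1⟩ = ch.paOut v y ⟨w.1, w.2.2⟩ := fun y w => rfl
    simp only [h3] at h1
    exact h1.trans h2.symm

end PosetMarkovChannel

/-! ### The converse bound for a single code -/

namespace PosetMarkovChannel

open scoped Classical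

variable {V X Y : Type*} [PartialOrder V] [Fintype X] [Fintype Y] [MeasurableSpace Y]
  (ch : PosetMarkovChannel V X Y) {n M : ℕ} (f : ch.Encoder n M)

theorem codeExp_add (G H : Fin M → (ch.nodes n → Y) → ℝ) :
    ch.codeExp f (fun m y => G m y + H m y) = ch.codeExp f G + ch.codeExp f H := by
  simp only [codeExp, mul_add, Finset.sum_add_distrib]

theorem codeExp_mono {G H : Fin M → (ch.nodes n → Y) → ℝ}
    (h : ∀ m y, ch.outputProb f m y ≠ 0 → G m y ≤ H m y) : ch.codeExp f G ≤ ch.codeExp f H := by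
  refine mul_le_mul_of_nonneg_left (Finset.sum_le_sum fun m _ => Finset.sum_le_sum fun y _ => ?_)
    (by positivity)
  rcases eq_or_ne (ch.outputProb f m y) 0 with h0 | h0
  · rw [h0, zero_mul, zero_mul]
  · exact mul_le_mul_of_nonneg_left (h m y h0) (ch.outputProb_nonneg f m y)

theorem errorProb_eq_codeExp (g : ch.Decoder n M) :
    ch.errorProb f g =
      ch.codeExp f (fun m y => if g (fun v => y (ch.coord v)) ≠ m then 1 else 0) := by
  unfold PosetCausalChannel.errorProb codeExp
  congr 1
  refine Finset.sum_congr rfl fun m _ => Finset.sum_congr rfl fun y _ => ?_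
  rw [mul_ite, mul_one, mul_zero]
  rfl

/-- A guess of the message given the decoder's output: the decoder is trusted with weight `1 - ε`,
and the weight `ε` is spread uniformly. -/
def guess (M : ℕ) (ε : ℝ) (k m : Fin M) : ℝ := (1 - ε) * (if k = m then 1 else 0) + ε / M

theorem guess_pos {ε : ℝ} (h0 : 0 < ε) (h1 : ε < 1) (hM : 1 ≤ M) (k m : Fin M) :
    0 < guess M ε k m := by
  have hM0 : (0 : ℝ) < M := Nat.cast_pos.2 (by omega)
  have : 0 < ε / M := div_pos h0 hM0
  unfold guess
  split_ifs <;> linarith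

theorem sum_guess {ε : ℝ} (hM : 1 ≤ M) (k : Fin M) : ∑ m, guess M ε k m = 1 := by
  have hM0 : (M : ℝ) ≠ 0 := Nat.cast_ne_zero.2 (by omega)
  simp only [guess, Finset.sum_add_distrib, ← Finset.mul_sum, Finset.sum_ite_eq, Finset.mem_univ,
    if_true, Finset.sum_const, Finset.card_univ, Fintype.card_fin, nsmul_eq_mul]
  field_simp
  ring

theorem neg_log_guess_le {ε : ℝ} (h0 : 0 < ε) (h1 : ε < 1) (hM : 1 ≤ M) (k m : Fin M) :
    -Real.log (guess M ε k m) ≤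
      -Real.log (1 - ε) + (if k ≠ m then 1 else 0) * (Real.log M - Real.log ε) := by
  have hM0 : (0 : ℝ) < M := Nat.cast_pos.2 (by omega)
  have hlog : Real.log (1 - ε) ≤ 0 := Real.log_nonpos (by linarith) (by linarith)
  by_cases h : k = m
  · have h2 : 1 - ε ≤ guess M ε k m := by
      have : 0 < ε / M := div_pos h0 hM0
      simp only [guess, h, if_true]
      linarith
    have h3 := Real.log_le_log (by linarith) h2
    simp only [h, ne_eq, not_true_eq_false, if_false]
    rw [h] at h3
    linarith
  · have h2 : guess M ε k m = ε / M := by simp [guess, h]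
    rw [h2, Real.log_div h0.ne' hM0.ne']
    simp only [ne_eq, h, not_false_eq_true, if_true]
    linarith

/-- The excess in the converse bound, which vanishes with `ε`. -/
def fanoExcess (ε : ℝ) : ℝ := -Real.log (1 - ε) - ε * Real.log ε

theorem fanoExcess_nonneg {ε : ℝ} (h0 : 0 < ε) (h1 : ε < 1) : 0 ≤ fanoExcess ε := by
  have h2 : Real.log (1 - ε) ≤ 0 := Real.log_nonpos (by linarith) (by linarith)
  have h3 := mul_nonpos_of_nonneg_of_nonpos h0.le (Real.log_nonpos h0.le h1.le)
  unfold fanoExcess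
  linarith

/-- The logarithmic likelihood ratio at `v`: the channel law against the conditional law of the
output at `v` given the outputs of its parents. -/
def llr (v : ch.CommNode n) (x : X) (b : Y) (t : ch.Pa v.1 → Y) : ℝ :=
  Real.log ((ch.localLaw v.1 x t).1 b /
    condOut (ch.localLaw v.1) (ch.inducedLaw f v) b t)

theorem codeExp_llr [Nonempty Y] (v : ch.CommNode n) :
    ch.codeExp f (fun m y => ch.llr f v (ch.inputAt f m v y) (y (ch.coord v)) (ch.paOut v y)) =
      condMutualInfo (ch.localJoint v.1 (ch.inducedLaw f v)) := by
  rw [localJoint_eq, condMutualInfo_chanJoint _ (ch.inducedLaw_nonneg f v)]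
  exact (ch.sum_localJoint_inducedLaw_mul f v (ch.llr f v)).symm

/-- Outputs of positive probability have positive conditional probabilities at all nodes. -/
theorem condOut_inducedLaw_ne_zero (hM : 1 ≤ M) {m : Fin M} {y : ch.nodes n → Y}
    (h : ch.outputProb f m y ≠ 0) (v : ch.CommNode n) :
    condOut (ch.localLaw v.1) (ch.inducedLaw f v) (y (ch.coord v)) (ch.paOut v y) ≠ 0 := by
  have hM0 : (0 : ℝ) < M := Nat.cast_pos.2 (by omega)
  refine condOut_ne_zero (a := ch.inputAt f m v y) _ (ch.inducedLaw_nonneg f v) ?_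
  refine mul_ne_zero ?_ (ne_of_gt ?_)
  · rw [outputProb_eq] at h
    exact Finset.prod_ne_zero_iff.1 (right_ne_zero_of_mul h) v (Finset.mem_univ v)
  · refine mul_pos (by positivity) (Finset.sum_pos' (fun m' _ => Finset.sum_nonneg fun y' _ =>
      mul_nonneg (ch.outputProb_nonneg f m' y') (by dsimp only; split_ifs <;> norm_num))
      ⟨m, Finset.mem_univ m, Finset.sum_pos' (fun y' _ =>
        mul_nonneg (ch.outputProb_nonneg f m y') (by dsimp only; split_ifs <;> norm_num))
        ⟨y, Finset.mem_univ y, ?_⟩⟩)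
    simpa using (ch.outputProb_nonneg f m y).lt_of_ne' h

/-- The converse: Gibbs' inequality for the law of message and outputs under the code, against the
law in which the outputs are drawn from their conditional laws given the parents' outputs and the
message is guessed from the decoder's output. -/
theorem log_card_le_sum_condMutualInfo [MeasurableSingletonClass Y] [Nonempty Y]
    {ε : ℝ} (h0 : 0 < ε) (h1 : ε < 1) (hM : 1 ≤ M) (g : ch.Decoder n M)
    (herr : ch.errorProb f g ≤ ε) :
    (1 - ε) * Real.log M ≤
      ∑ v, condMutualInfo (ch.localJoint v.1 (ch.inducedLaw f v)) + fanoExcess ε := by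
  have hM0 : (0 : ℝ) < M := Nat.cast_pos.2 (by omega)
  set r : (v : ch.CommNode n) → Y → (ch.Pa v.1 → Y) → ℝ := fun v =>
    condOut (ch.localLaw v.1) (ch.inducedLaw f v) with hr
  set q : Fin M × (ch.nodes n → Y) → ℝ := fun z =>
    guess M ε (g fun v => z.2 (ch.coord v)) z.1 *
      (ch.initProb z.2 * ∏ v, r v (z.2 (ch.coord v)) (ch.paOut v z.2)) with hq
  set p : Fin M × (ch.nodes n → Y) → ℝ := fun z => 1 / (M : ℝ) * ch.outputProb f z.1 z.2 with hp
  have hr0 : ∀ v b t, 0 ≤ r v b t := fun v => condOut_nonneg _ (ch.inducedLaw_nonneg f v)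
  have hpsum : ∑ z, p z = 1 := by
    have := ch.codeExp_const f hM 1
    rw [Fintype.sum_prod_type]
    simpa [hp, codeExp, Finset.mul_sum] using this
  have hqsum : ∑ z, q z = 1 := by
    rw [Fintype.sum_prod_type, Finset.sum_comm]
    simp only [hq, ← Finset.sum_mul, sum_guess hM, one_mul]
    exact ch.sum_initProb_mul_prod (ch.isCausalKernel_of_paOut r fun v t => sum_condOut _ _ t)
  have hpq : ∀ z, q z = 0 → p z = 0 := by
    intro z hz
    by_contra hpz
    have hout : ch.outputProb f z.1 z.2 ≠ 0 := right_ne_zero_of_mul hpz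
    refine mul_ne_zero (guess_pos h0 h1 hM _ _).ne' (mul_ne_zero ?_ ?_) hz
    · rw [outputProb_eq] at hout
      exact left_ne_zero_of_mul hout
    · exact Finset.prod_ne_zero_iff.2 fun v _ => ch.condOut_inducedLaw_ne_zero f hM hout v
  have hgibbs := sum_mul_log_div_nonneg p q
    (fun z => mul_nonneg (by positivity) (ch.outputProb_nonneg f z.1 z.2))
    (fun z => mul_nonneg (guess_pos h0 h1 hM _ _).le (mul_nonneg (ch.initProb_nonneg _)
      (Finset.prod_nonneg fun v _ => hr0 v _ _))) hpq (by rw [hpsum, hqsum])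
  have heq : ∑ z, p z * Real.log (p z / q z) =
      ch.codeExp f fun m y => Real.log (p (m, y) / q (m, y)) := by
    rw [Fintype.sum_prod_type, codeExp, Finset.mul_sum]
    simp only [Finset.mul_sum, hp, mul_assoc]
  have hle : ch.codeExp f (fun m y => Real.log (p (m, y) / q (m, y))) ≤
      ch.codeExp f fun m y => ((-Real.log M - Real.log (1 - ε)) +
        ∑ v, ch.llr f v (ch.inputAt f m v y) (y (ch.coord v)) (ch.paOut v y)) +
        (if g (fun v => y (ch.coord v)) ≠ m then 1 else 0) * (Real.log M - Real.log ε) := by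
    refine ch.codeExp_mono f fun m y hout => ?_
    have hker := hout
    rw [outputProb_eq] at hker
    have hinit := left_ne_zero_of_mul hker
    have hprod := right_ne_zero_of_mul hker
    have hrprod : ∏ v, r v (y (ch.coord v)) (ch.paOut v y) ≠ 0 :=
      Finset.prod_ne_zero_iff.2 fun v _ => ch.condOut_inducedLaw_ne_zero f hM hout v
    have hg := (guess_pos h0 h1 hM (g fun v => y (ch.coord v)) m).ne'
    have h2 : p (m, y) / q (m, y) = (M : ℝ)⁻¹ *
        ((∏ v, ch.kernel f m v y / r v (y (ch.coord v)) (ch.paOut v y)) /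
          guess M ε (g fun v => y (ch.coord v)) m) := by
      simp only [hp, hq, outputProb_eq, Finset.prod_div_distrib]
      field_simp
    have hratio : ∀ v ∈ (Finset.univ : Finset (ch.CommNode n)),
        ch.kernel f m v y / r v (y (ch.coord v)) (ch.paOut v y) ≠ 0 := fun v hv =>
      div_ne_zero (Finset.prod_ne_zero_iff.1 hprod v hv) (Finset.prod_ne_zero_iff.1 hrprod v hv)
    rw [h2, Real.log_mul (inv_ne_zero hM0.ne') (div_ne_zero (Finset.prod_ne_zero_iff.2 hratio) hg),
      Real.log_inv, Real.log_div (Finset.prod_ne_zero_iff.2 hratio) hg, Real.log_prod hratio]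
    have h3 := neg_log_guess_le h0 h1 hM (g fun v => y (ch.coord v)) m
    change -Real.log M + ((∑ v, ch.llr f v (ch.inputAt f m v y) (y (ch.coord v)) (ch.paOut v y)) -
      _) ≤ _
    linarith
  rw [heq] at hgibbs
  have hfin := hgibbs.trans hle
  rw [codeExp_add, codeExp_add, codeExp_sum, codeExp_const _ f hM, codeExp_mul_const,
    ← errorProb_eq_codeExp] at hfin
  simp only [codeExp_llr] at hfin
  have hnonneg : 0 ≤ Real.log M - Real.log ε := by
    have := Real.log_nonneg (Nat.one_le_cast.2 hM : (1 : ℝ) ≤ M)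
    have := Real.log_nonpos h0.le h1.le
    linarith
  have := mul_le_mul_of_nonneg_right herr hnonneg
  unfold fanoExcess
  linarith

/-! ### Asymptotics -/

variable [Nonempty X] [Nonempty Y] [MeasurableSingletonClass Y]

theorem feasible_nonempty (n : ℕ) : (ch.feasible n).Nonempty :=
  ⟨_, ch.inducedLaw_mem_feasible (M := 1) (fun _ _ _ => Classical.arbitrary X) le_rfl⟩

theorem objective_le_programValue {n : ℕ} {P : ch.LocalVars n} (hP : P ∈ ch.feasible n) :
    ch.objective n P ≤ ch.programValue n :=
  (ch.isGreatest_programValue (ch.feasible_nonempty n)).2 ⟨P, hP, rfl⟩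

theorem log_le_of_mem_codeSizes {ε : ℝ} (h0 : 0 < ε) (h1 : ε < 1) (hM : M ∈ ch.codeSizes n ε) :
    (1 - ε) * Real.log M ≤ ch.numComm n * ch.programValue n + fanoExcess ε := by
  obtain ⟨hM1, f, g, herr⟩ := hM
  refine (ch.log_card_le_sum_condMutualInfo f h0 h1 hM1 g herr).trans ?_
  have h2 := ch.objective_le_programValue (ch.inducedLaw_mem_feasible f hM1)
  have h3 : ∑ v, condMutualInfo (ch.localJoint v.1 (ch.inducedLaw f v)) =
      ch.numComm n * ch.objective n (ch.inducedLaw f) := by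
    unfold objective
    rcases Nat.eq_zero_or_pos (ch.numComm n) with hN | hN
    · have : IsEmpty (ch.CommNode n) := Fintype.card_eq_zero_iff.1 hN
      simp [hN]
    · have : (ch.numComm n : ℝ) ≠ 0 := Nat.cast_ne_zero.2 hN.ne'
      field_simp
  rw [h3]
  have := mul_le_mul_of_nonneg_left h2 (Nat.cast_nonneg (α := ℝ) (ch.numComm n))
  linarith

theorem one_mem_codeSizes (n : ℕ) {ε : ℝ} (h0 : 0 < ε) : 1 ∈ ch.codeSizes n ε := by
  refine ⟨le_rfl, fun _ _ _ => Classical.arbitrary X, fun _ => 0, ?_⟩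
  have h : ∀ m : Fin 1, ¬ (0 : Fin 1) ≠ m := fun m h => h (Subsingleton.elim _ _)
  simp only [PosetCausalChannel.errorProb, h, if_false, Finset.sum_const_zero, mul_zero]
  exact h0.le

theorem bddAbove_codeSizes (n : ℕ) {ε : ℝ} (h0 : 0 < ε) (h1 : ε < 1) :
    BddAbove (ch.codeSizes n ε) := by
  refine ⟨⌊Real.exp ((ch.numComm n * ch.programValue n + fanoExcess ε) / (1 - ε))⌋₊,
    fun M hM => Nat.le_floor ?_⟩
  have hM0 : (0 : ℝ) < M := Nat.cast_pos.2 hM.1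
  rw [← Real.log_le_iff_le_exp hM0, le_div_iff₀ (by linarith), mul_comm]
  exact ch.log_le_of_mem_codeSizes h0 h1 hM

theorem isGreatest_maxSize (n : ℕ) {ε : ℝ} (h0 : 0 < ε) (h1 : ε < 1) :
    IsGreatest (ch.codeSizes n ε) (ch.maxSize n ε) :=
  ⟨Nat.sSup_mem ⟨1, ch.one_mem_codeSizes n h0⟩ (ch.bddAbove_codeSizes n h0 h1),
    fun _ hM => le_csSup (ch.bddAbove_codeSizes n h0 h1) hM⟩

theorem rate_le {n : ℕ} {ε : ℝ} (h0 : 0 < ε) (h1 : ε < 1) :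
    1 / (ch.numComm n : ℝ) * Real.log (ch.maxSize n ε) ≤
      (ch.programValue n + fanoExcess ε) / (1 - ε) := by
  have hδ := fanoExcess_nonneg h0 h1
  rw [le_div_iff₀ (by linarith)]
  rcases Nat.eq_zero_or_pos (ch.numComm n) with hN | hN
  · -- without communication nodes both sides are governed by the convention `1 / 0 = 0`
    obtain ⟨P, -, hP⟩ := (ch.isGreatest_programValue (ch.feasible_nonempty n)).1
    have hU : ch.programValue n = 0 := by simp [← hP, objective, hN]
    simpa [hN, hU] using hδ
  · have hN1 : (1 : ℝ) ≤ ch.numComm n := Nat.one_le_cast.2 hN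
    have h2 := ch.log_le_of_mem_codeSizes h0 h1 (ch.isGreatest_maxSize n h0 h1).1
    have h3 : fanoExcess ε ≤ ch.numComm n * fanoExcess ε := le_mul_of_one_le_left hδ hN1
    have hN0 : (0 : ℝ) < ch.numComm n := by linarith
    rw [one_div, mul_assoc, inv_mul_le_iff₀ hN0]
    linarith

theorem epsRate_monotoneOn : MonotoneOn ch.epsRate (Set.Ioo 0 1) := by
  intro ε hε ε' hε' h
  refine liminf_le_liminf (Eventually.of_forall fun n => ?_)
  refine EReal.coe_le_coe_iff.2 (mul_le_mul_of_nonneg_left ?_ (by positivity))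
  obtain ⟨hM, f, g, herr⟩ := (ch.isGreatest_maxSize n hε.1 hε.2).1
  refine Real.log_le_log (Nat.cast_pos.2 hM) (Nat.cast_le.2 ?_)
  exact (ch.isGreatest_maxSize n hε'.1 hε'.2).2 ⟨hM, f, g, herr.trans h⟩

theorem tendsto_epsRate : Tendsto ch.epsRate (𝓝[>] (0 : ℝ)) (𝓝 ch.feedbackCapacity) :=
  tendsto_nhds_limUnder ⟨_, ch.epsRate_monotoneOn.tendsto_nhdsWithin_Ioo_right
    (Set.nonempty_Ioo.2 one_pos) (OrderBot.bddBelow _)⟩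

theorem tendsto_add_fanoExcess_div (c : ℝ) :
    Tendsto (fun ε => (c + fanoExcess ε) / (1 - ε)) (𝓝[>] (0 : ℝ)) (𝓝 c) := by
  have h : ContinuousAt (fun ε : ℝ => (c + fanoExcess ε) / (1 - ε)) 0 := by
    unfold fanoExcess
    refine ContinuousAt.div ?_ (by fun_prop) (by norm_num)
    refine continuousAt_const.add (ContinuousAt.sub ?_ Real.continuous_mul_log.continuousAt)
    exact (ContinuousAt.log (by fun_prop) (by norm_num)).neg
  have h2 := h.tendsto
  simp only [fanoExcess, sub_zero, Real.log_one, neg_zero, zero_mul, add_zero, div_one] at h2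
  exact h2.mono_left nhdsWithin_le_nhds

theorem feedbackCapacity_le_liminf :
    ch.feedbackCapacity ≤ liminf (fun n => (ch.programValue n : EReal)) atTop := by
  refine EReal.le_of_forall_lt_iff_le.1 fun c hc => ?_
  have hfreq : ∃ᶠ n in atTop, (ch.programValue n : EReal) < c :=
    frequently_lt_of_liminf_lt (by isBoundedDefault) hc
  refine le_of_tendsto_of_tendsto ch.tendsto_epsRate
    ((continuous_coe_real_ereal.tendsto c).comp (tendsto_add_fanoExcess_div c)) ?_
  filter_upwards [Ioo_mem_nhdsGT one_pos] with ε hε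
  refine liminf_le_of_frequently_le' (hfreq.mono fun n hn => EReal.coe_le_coe_iff.2 ?_)
  refine (ch.rate_le hε.1 hε.2).trans ?_
  have h1 : 0 ≤ 1 - ε := by linarith [hε.2]
  exact div_le_div_of_nonneg_right (add_le_add_left (EReal.coe_lt_coe_iff.1 hn).le _) h1

end PosetMarkovChannel

end

theorem mainTheorem2 {V X Y : Type*} [PartialOrder V]
    [Fintype X] [Nonempty X] [Fintype Y] [Nonempty Y]
    [MeasurableSpace Y] [MeasurableSingletonClass Y]
    (ch : PosetMarkovChannel V X Y) :
    -- the quantities that define the feedback capacity exist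
    (∀ (n : ℕ) (ε : ℝ), 0 < ε → ε < 1 → IsGreatest (ch.codeSizes n ε) (ch.maxSize n ε)) ∧
    Tendsto ch.epsRate (𝓝[>] (0 : ℝ)) (𝓝 ch.feedbackCapacity) ∧
    -- each program is a concave maximization over a convex set, and its maximum is attained
    (∀ n : ℕ, Convex ℝ (ch.feasible n) ∧ ConcaveOn ℝ (ch.feasible n) (ch.objective n) ∧
      IsGreatest (ch.objective n '' ch.feasible n) (ch.programValue n)) ∧
    -- the upper bound
    ch.feedbackCapacity ≤ liminf (fun n => (ch.programValue n : EReal)) atTop ∧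
    (∀ L : ℝ, Tendsto ch.programValue atTop (𝓝 L) → ch.feedbackCapacity ≤ (L : EReal)) := by
  refine ⟨fun n ε h0 h1 => ch.isGreatest_maxSize n h0 h1, ch.tendsto_epsRate,
    fun n => ⟨ch.convex_feasible n, ch.concaveOn_objective n,
      ch.isGreatest_programValue (ch.feasible_nonempty n)⟩,
    ch.feedbackCapacity_le_liminf, fun L hL => ?_⟩
  have h : Tendsto (fun n => (ch.programValue n : EReal)) atTop (𝓝 (L : EReal)) :=
    (continuous_coe_real_ereal.tendsto L).comp hL
  exact h.liminf_eq ▸ ch.feedbackCapacity_le_liminf
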